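/- Let $R$ be a commutative ring with identity and let $A=(a_{ij})_{1\le i,j\le n}$ be a matrix over $R$. Write $\operatorname{per}(B)=\sum_{\sigma\in S_n}\prod_{i=1}^n b_{i,\sigma(i)}$ for the permanent of an $n\times n$ matrix $B$, $\varepsilon(\sigma)$ for the sign of a permutation $\sigma\in S_n$, $\mathbb N=\{0,1,2,\ldots\}$, and $[x_1^{k_1}\cdots x_n^{k_n}]P$ for the coefficient of $x_1^{k_1}\cdots x_n^{k_n}$ in $P\in R[x_1,\ldots,x_n]$. (i) Let $k_1,m_1,\ldots,k_n,m_n\in\mathbb N$ and $\delta\in\{0,1\}$ with $M:=\sum_{i=1}^n m_i+\delta\binom n2\le\sum_{i=1}^n k_i$. For $\sigma\in S_n$ put $$D_\sigma=\{k_{\sigma(1)}-m_1,\ldots,k_{\sigma(n)}-m_n\}\subseteq\mathbb Z,\qquad T_n=\{\sigma\in S_n:\ D_\sigma\subseteq\mathbb N\text{ and }|D_\sigma|=n\},$$ $$N_\sigma=\frac{(k_1+\cdots+k_n-M)!}{\prod_{i=1}^n\ \prod_{\substack{0\le j<k_{\sigma(i)}-m_i\\ j\notin D_\sigma\text{ if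 }\delta=1}}(k_{\sigma(i)}-m_i-j)} .$$ Then $N_\sigma$ is a positive integer for all $\sigma\in S_n$ with $D_\sigma\subseteq\mathbb N$ if $\delta=0$, and for all $\sigma\in T_n$ if $\delta=1$. For each $\sigma\in T_n$ there is a unique $\sigma'\in S_n$ with $$0\le k_{\sigma(\sigma'(1))}-m_{\sigma'(1)}<\cdots<k_{\sigma(\sigma'(n))}-m_{\sigma'(n)},$$ and $$[x_1^{k_1}\cdots x_n^{k_n}]\ \operatorname{per}\bigl(a_{ij}x_j^{m_i}\bigr)_{1\le i,j\le n}\prod_{1\le i<j\le n}(x_j-x_i)^\delta\cdot\Bigl(\sum_{s=1}^n x_s\Bigr)^{\sum_{i=1}^n k_i-M} =\begin{cases}\displaystyle\sum_{\sigma\in S_n,\ D_\sigma\subseteq\mathbb N}N_\sigma\prod_{i=1}^n a_{i,\sigma(i)}&\text{if }\delta=0,\\[2ex] \displaystyle\sum_{\sigma\in T_n}\varepsilon(\sigma\sigma')N_\sigma\prod_{i=1}^n a_{i,\sigma(i)}&\text{if }\delta=1.\end{cases}$$ (ii) Let $k,m_1,\ldots,m_n\in\mathbb N$ with $m_1\le\cdots\le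 m_n\le k$. Then $$[x_1^k\cdots x_n^k]\ \operatorname{per}\bigl(a_{ij}x_j^{m_i}\bigr)_{1\le i,j\le n}(x_1+\cdots+x_n)^{kn-\sum_{i=1}^n m_i}=\frac{(kn-\sum_{i=1}^n m_i)!}{\prod_{i=1}^n(k-m_i)!}\operatorname{per}(A).$$ If moreover $m_1<\cdots<m_n$, then $\binom n2+\sum_{i=1}^n m_i\le kn$ and $$[x_1^k\cdots x_n^k]\ \operatorname{per}\bigl(a_{ij}x_j^{m_i}\bigr)_{1\le i,j\le n}\prod_{1\le i<j\le n}(x_j-x_i)\cdot\Bigl(\sum_{s=1}^n x_s\Bigr)^{kn-\binom n2-\sum_{i=1}^n m_i} =(-1)^{\binom n2}\frac{(kn-\binom n2-\sum_{i=1}^n m_i)!}{\prod_{i=1}^n\ \prod_{\substack{m_i<j\le k\\ j\notin\{m_s:\ i<s\le n\}}}(j-m_i)}\det(A).$$ The two quotients in (ii) are integers. -/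

import Mathlib

namespace PermanentDual

/-- The matrix `(a_{ij} x_j^{m_i})` over `R[x_1, …, x_n]`. -/
noncomputable def weightedMatrix {R : Type*} [CommRing R] {n : ℕ}
    (A : Matrix (Fin n) (Fin n) R) (m : Fin n → ℕ) :
    Matrix (Fin n) (Fin n) (MvPolynomial (Fin n) R) :=
  Matrix.of fun i j => MvPolynomial.C (A i j) * MvPolynomial.X j ^ m i

/-- The coefficient of `x_1^{k_1} ⋯ x_n^{k_n}` in `P`. -/
noncomputable def coeffAt {R : Type*} [CommRing R] {n : ℕ} (k : Fin n → ℕ)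
    (P : MvPolynomial (Fin n) R) : R :=
  MvPolynomial.coeff (Finsupp.equivFunOnFinite.symm k) P

/-- `∏_{i < j} (x_j - x_i)^δ`. -/
noncomputable def vandermondePow (R : Type*) [CommRing R] (n δ : ℕ) : MvPolynomial (Fin n) R :=
  ∏ i : Fin n, ∏ j ∈ Finset.Ioi i, (MvPolynomial.X j - MvPolynomial.X i) ^ δ

/-- `M = m_1 + ⋯ + m_n + δ * (n choose 2)`. -/
def totalM {n : ℕ} (m : Fin n → ℕ) (δ : ℕ) : ℕ := ∑ i, m i + δ * n.choose 2

/-- The (possibly negative) integer `k_{σ(i)} - m_i`. -/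
def diff {n : ℕ} (k m : Fin n → ℕ) (σ : Equiv.Perm (Fin n)) (i : Fin n) : ℤ :=
  (k (σ i) : ℤ) - (m i : ℤ)

/-- The set `D_σ = {k_{σ(1)} - m_1, …, k_{σ(n)} - m_n}` of integers. -/
def D {n : ℕ} (k m : Fin n → ℕ) (σ : Equiv.Perm (Fin n)) : Finset ℤ :=
  Finset.univ.image (diff k m σ)

/-- The permutations `σ` with `D_σ ⊆ ℕ`. -/
def S {n : ℕ} (k m : Fin n → ℕ) : Finset (Equiv.Perm (Fin n)) :=
  Finset.univ.filter fun σ => ∀ d ∈ D k m σ, 0 ≤ d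

/-- `T_n`: the permutations `σ` with `D_σ ⊆ ℕ` and `|D_σ| = n`. -/
def T {n : ℕ} (k m : Fin n → ℕ) : Finset (Equiv.Perm (Fin n)) :=
  Finset.univ.filter fun σ => (∀ d ∈ D k m σ, 0 ≤ d) ∧ (D k m σ).card = n

/-- The numerator `(k_1 + ⋯ + k_n - M)!` of `N_σ`. -/
def numN {n : ℕ} (k m : Fin n → ℕ) (δ : ℕ) : ℤ :=
  (Nat.factorial (∑ i, k i - totalM m δ) : ℤ)

/-- The denominator of `N_σ`: the product over `i` and over the integers
`0 ≤ j < k_{σ(i)} - m_i` (with `j ∉ D_σ` if `δ = 1`) of `k_{σ(i)} - m_i - j`. -/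
noncomputable def denN {n : ℕ} (k m : Fin n → ℕ) (δ : ℕ) (σ : Equiv.Perm (Fin n)) : ℤ :=
  ∏ i, ∏ j ∈ (Finset.Ico 0 (diff k m σ i)).filter (fun j => δ = 1 → j ∉ D k m σ),
    (diff k m σ i - j)

/-- The number `N_σ`. -/
noncomputable def N {n : ℕ} (k m : Fin n → ℕ) (δ : ℕ) (σ : Equiv.Perm (Fin n)) : ℤ :=
  numN k m δ / denN k m δ σ

/-- `τ` satisfies `0 ≤ k_{σ(τ(1))} - m_{τ(1)} < ⋯ < k_{σ(τ(n))} - m_{τ(n)}`. -/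
def Sorts {n : ℕ} (k m : Fin n → ℕ) (σ τ : Equiv.Perm (Fin n)) : Prop :=
  (∀ i, 0 ≤ diff k m σ (τ i)) ∧ StrictMono fun i => diff k m σ (τ i)

/-- The permutation `σ'` that sorts the integers `k_{σ(i)} - m_i` (for `σ ∈ T_n`, it is the only
one with `Sorts k m σ σ'`). -/
def sortPerm {n : ℕ} (k m : Fin n → ℕ) (σ : Equiv.Perm (Fin n)) : Equiv.Perm (Fin n) :=
  Tuple.sort (diff k m σ)

/-- `∏_i (k - m_i)!`. -/
def den₀ {n : ℕ} (k : ℕ) (m : Fin n → ℕ) : ℕ := ∏ i, Nat.factorial (k - m i)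

/-- The product over `i` and over `m_i < j ≤ k` with `j ∉ {m_s : i < s ≤ n}` of `j - m_i`. -/
def den₁ {n : ℕ} (k : ℕ) (m : Fin n → ℕ) : ℕ :=
  ∏ i, ∏ j ∈ (Finset.Ioc (m i) k).filter (fun j => j ∉ (Finset.Ioi i).image m), (j - m i)

end PermanentDual

namespace PermanentDual

open Finset MvPolynomial

/-! Expanding the permanent, each `σ` contributes `∏ a_{i,σ(i)}` times a monomial, so what remains
is the coefficient of `x^d`, with `d_j = k_j - m_{σ⁻¹(j)}`, in the Vandermonde product (if `δ = 1`)
times a power of `∑ x_s`; it vanishes unless `σ ∈ S`. This coefficient is the image of an integer,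
so it may be computed over `ℤ`, where cancellation is allowed.

For `δ = 0` it is a multinomial coefficient. For `δ = 1`, expanding the Vandermonde determinant and
clearing `∏ d_j!` gives `N!` times the determinant of falling factorials `(d_i)_j`, which is the
Vandermonde determinant of `d` (`coeff_vandermondePow_one_mul`). If two `d_j` coincide this is zero.
Otherwise it is a sign times `pairProd`, and the same `pairProd` is the factor of `∏ d_j!` missing
from the denominator of `N_σ` (`det_vandermonde_eq_sign_mul`, `prod_factorial_eq`). Cancelling it
yields `± N_σ`, and integrality comes for free since a coefficient is an integer.

For constant `k` the denominators do not depend on `σ` and the sorting permutation is always the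
reversal, so the sums collapse to `per A` and `± det A`. -/

theorem coeff_sum_X_pow {ι R : Type*} [Fintype ι] [DecidableEq ι] [CommSemiring R]
    (d : ι →₀ ℕ) (N : ℕ) :
    coeff d ((∑ s, X s : MvPolynomial ι R) ^ N) =
      if ∑ i, d i = N then (Nat.multinomial univ d : R) else 0 := by
  have key (f : ι → ℕ) : (∏ i, (X i : MvPolynomial ι R) ^ f i) =
      monomial (Finsupp.equivFunOnFinite.symm f) 1 := by
    rw [monomial_eq, C_1, one_mul, Finsupp.prod_fintype _ _ (by simp)]
    rfl
  rw [Finset.sum_pow_eq_sum_piAntidiag, coeff_sum]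
  simp only [key, ← C_eq_coe_nat, coeff_C_mul, coeff_monomial, mul_ite, mul_one, mul_zero]
  have h2 (f : ι → ℕ) : Finsupp.equivFunOnFinite.symm f = d ↔ f = d := by
    rw [Equiv.symm_apply_eq]; rfl
  simp only [h2, Finset.sum_ite_eq', mem_piAntidiag]
  simp

theorem sum_val_fin (n : ℕ) : ∑ i : Fin n, (i : ℕ) = n.choose 2 := by
  rw [Fin.sum_univ_eq_sum_range (fun i => i) n, Finset.sum_range_id, Nat.choose_two_right]

theorem vandermondePow_one (R : Type*) [CommRing R] (n : ℕ) :
    vandermondePow R n 1 = ∑ τ : Equiv.Perm (Fin n), C ((Equiv.Perm.sign τ : ℤ) : R) *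
      monomial (Finsupp.equivFunOnFinite.symm fun i => ((τ i : Fin n) : ℕ)) 1 := by
  have : vandermondePow R n 1 =
      (Matrix.vandermonde (X : Fin n → MvPolynomial (Fin n) R)).det := by
    simp [vandermondePow, Matrix.det_vandermonde]
  rw [this, ← Matrix.det_transpose, Matrix.det_apply']
  refine Finset.sum_congr rfl fun τ _ => ?_
  rw [monomial_eq, C_1, one_mul, Finsupp.prod_fintype _ _ (by simp)]
  simp

/-- The falling factorials are values of monic polynomials of degree `j`, so they differ from the
powers by unitriangular column operations. -/
theorem det_descFactorial {n : ℕ} (d : Fin n → ℕ) :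
    (Matrix.of fun i j : Fin n => ((d i).descFactorial j : ℤ)).det =
      (Matrix.vandermonde fun i => (d i : ℤ)).det := by
  rw [Matrix.det_eval_matrixOfPolynomials_eq_det_vandermonde _
    (fun j => descPochhammer ℤ j) (fun i => descPochhammer_natDegree ℤ i)
    (fun i => monic_descPochhammer ℤ i)]
  simp only [descPochhammer_eval_eq_descFactorial]

/-- The coefficients of the product of the Vandermonde polynomial and a power of the sum of the
variables, after clearing denominators. -/
theorem coeff_vandermondePow_one_mul {n : ℕ} (d : Fin n →₀ ℕ) (N : ℕ)
    (h : ∑ i, d i = N + n.choose 2) :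
    coeff d (vandermondePow ℤ n 1 * (∑ s, X s) ^ N) * ∏ i, ((d i).factorial : ℤ) =
      N.factorial * (Matrix.vandermonde fun i => (d i : ℤ)).det := by
  rw [← det_descFactorial, ← Matrix.det_transpose, Matrix.det_apply', vandermondePow_one,
    Finset.sum_mul, coeff_sum, Finset.sum_mul, Finset.mul_sum]
  refine Finset.sum_congr rfl fun τ _ => ?_
  rw [mul_assoc, coeff_C_mul, coeff_monomial_mul', one_mul, coeff_sum_X_pow]
  simp only [Matrix.transpose_apply, Matrix.of_apply, Int.cast_id]
  split_ifs with h1 h2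
  · have h1' : ∀ i, ((τ i : Fin n) : ℕ) ≤ d i := fun i => h1 i
    have hm := Nat.multinomial_spec (univ : Finset (Fin n))
      ⇑(d - Finsupp.equivFunOnFinite.symm fun i => ((τ i : Fin n) : ℕ))
    rw [h2] at hm
    have hd : ∏ i, (d i).factorial = (∏ i, (d i).descFactorial (τ i)) *
        ∏ i, ((d - Finsupp.equivFunOnFinite.symm fun i => ((τ i : Fin n) : ℕ)) i).factorial := by
      rw [← Finset.prod_mul_distrib]
      refine Finset.prod_congr rfl fun i _ => ?_
      rw [mul_comm]
      exact (Nat.factorial_mul_descFactorial (h1' i)).symm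
    rw [← hm, ← Nat.cast_prod, hd]
    push_cast
    ring
  -- The degrees always match: the exponents of a Vandermonde monomial sum to `n.choose 2`.
  · exfalso
    apply h2
    have h1' : ∀ i, ((τ i : Fin n) : ℕ) ≤ d i := fun i => h1 i
    have : ∑ i, (d i - (τ i : ℕ)) = N := by
      rw [Finset.sum_tsub_distrib _ (fun i _ => h1' i), h,
        Equiv.sum_comp τ (fun i : Fin n => (i : ℕ)), sum_val_fin]
      simp
    exact this
  -- When the monomial of `τ` does not divide `x^d`, some falling factorial vanishes, so both sides
  -- are zero.
  · have : ∃ i, d i < ((τ i : Fin n) : ℕ) := by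
      by_contra! hc
      exact h1 fun i => hc i
    obtain ⟨i, hi⟩ := this
    have : ∏ i, ((d i).descFactorial (τ i) : ℤ) = 0 :=
      Finset.prod_eq_zero (mem_univ i) (by simpa using hi)
    rw [this]
    simp

/-! ### Factorials, Vandermonde determinants and signs -/

theorem prod_Ico_sub {d : ℤ} (hd : 0 ≤ d) :
    ∏ j ∈ Finset.Ico 0 d, (d - j) = (d.toNat.factorial : ℤ) := by
  lift d to ℕ using hd
  rw [Int.toNat_natCast, ← Finset.prod_range_add_one_eq_factorial, ← Finset.prod_range_reflect]
  push_cast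
  symm
  refine Finset.prod_bij (fun j _ => (j : ℤ)) ?_ ?_ ?_ ?_
  · intro j hj; simp at hj ⊢; omega
  · intro a _ b _ hab; exact_mod_cast hab
  · intro b hb
    simp at hb
    exact ⟨b.toNat, by simp; omega, by simp; omega⟩
  · intro j hj; simp at hj; omega

/-- The product over all ordered pairs with `d i' < d i` of the differences. -/
def pairProd {n : ℕ} (d : Fin n → ℤ) : ℤ := ∏ i, ∏ i' with d i' < d i, (d i - d i')

theorem pairProd_pos {n : ℕ} (d : Fin n → ℤ) : 0 < pairProd d :=
  Finset.prod_pos fun i _ => Finset.prod_pos fun j hj => by simp at hj; omega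

/-- Split the factors `d i - j` of `(d i)!` by whether `j` is a value of `d`. The values below `d i`
all occur, being nonnegative, and each occurs once by injectivity; they make up `pairProd`. -/
theorem prod_factorial_eq {n : ℕ} {d : Fin n → ℤ} (hd : ∀ i, 0 ≤ d i)
    (hinj : Function.Injective d) :
    ∏ i, ((d i).toNat.factorial : ℤ) =
      (∏ i, ∏ j ∈ Finset.Ico 0 (d i) with j ∉ univ.image d, (d i - j)) * pairProd d := by
  rw [pairProd, ← Finset.prod_mul_distrib]
  refine Finset.prod_congr rfl fun i _ => ?_
  rw [← prod_Ico_sub (hd i), ← Finset.prod_filter_not_mul_prod_filter _ (fun j => j ∈ univ.image d)]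
  congr 1
  rw [← Finset.prod_image (s := univ.filter fun i' => d i' < d i) (g := d)
    (f := fun j => d i - j) hinj.injOn]
  refine Finset.prod_congr ?_ fun _ _ => rfl
  ext j
  simp only [mem_filter, mem_Ico, mem_image, mem_univ, true_and]
  constructor
  · rintro ⟨⟨_, h⟩, i', rfl⟩; exact ⟨i', h, rfl⟩
  · rintro ⟨i', h, rfl⟩; exact ⟨⟨hd i', h⟩, i', rfl⟩

/-- After sorting the rows by `ρ`, the Vandermonde factors are exactly the positive differences; the
row permutation costs `sign ρ`. -/
theorem det_vandermonde_eq_sign_mul {n : ℕ} {d : Fin n → ℤ} {ρ : Equiv.Perm (Fin n)}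
    (hρ : StrictMono (d ∘ ρ)) :
    (Matrix.vandermonde d).det = (Equiv.Perm.sign ρ : ℤ) * pairProd d := by
  have h1 : (Matrix.vandermonde (d ∘ ρ)).det = pairProd d := by
    rw [Matrix.det_vandermonde, pairProd, ← Equiv.prod_comp ρ fun i => ∏ i' with d i' < d i, (d i - d i')]
    have h2 (i : Fin n) : ∏ i' with d i' < d (ρ i), (d (ρ i) - d i') =
        ∏ i' ∈ Finset.Iio i, (d (ρ i) - d (ρ i')) := by
      symm
      refine Finset.prod_bij (fun j _ => ρ j) ?_ ?_ ?_ ?_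
      · intro j hj; simp at hj ⊢; exact hρ hj
      · intro a _ b _ hab; exact ρ.injective hab
      · intro b hb
        obtain ⟨b, rfl⟩ := ρ.surjective b
        simp at hb
        exact ⟨b, by simpa using hρ.lt_iff_lt.1 hb, rfl⟩
      · intro j _; rfl
    simp only [h2]
    refine Finset.prod_comm' ?_
    simp
  have h3 : Matrix.vandermonde (d ∘ ρ) = (Matrix.vandermonde d).submatrix ρ id := rfl
  rw [h3, Matrix.det_permute] at h1
  rw [← h1, ← mul_assoc, ← Int.cast_id (n := (Equiv.Perm.sign ρ : ℤ)), ← Int.cast_mul]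
  simp [← Units.val_mul]

/-- Reversing the nodes `0, …, n-1` negates each of the `n.choose 2` Vandermonde factors, but also
multiplies the nonzero determinant by the sign of the reversal. -/
theorem sign_revPerm (n : ℕ) : Equiv.Perm.sign (Fin.revPerm : Equiv.Perm (Fin n)) =
    (-1) ^ n.choose 2 := by
  have hmono : StrictMono fun i : Fin n => ((i : ℕ) : ℤ) := fun i j h => by simpa using h
  have h1 : (Matrix.vandermonde ((fun i : Fin n => ((i : ℕ) : ℤ)) ∘ Fin.revPerm)).det =
      (-1) ^ n.choose 2 * (Matrix.vandermonde (fun i : Fin n => ((i : ℕ) : ℤ))).det := by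
    have hc : ∑ i : Fin n, #(Finset.Ioi i) = n.choose 2 := by
      rw [← sum_val_fin, ← Equiv.sum_comp Fin.revPerm]
      refine Finset.sum_congr rfl fun i _ => ?_
      simp
      omega
    rw [Matrix.det_vandermonde, Matrix.det_vandermonde, ← hc, ← Finset.prod_pow_eq_pow_sum,
      ← Finset.prod_mul_distrib]
    refine Finset.prod_congr rfl fun i _ => ?_
    rw [← Finset.prod_const, ← Finset.prod_mul_distrib]
    refine Finset.prod_congr rfl fun j _ => ?_
    have := i.isLt
    have := j.isLt
    simp only [Function.comp_apply, Fin.revPerm_apply, Fin.val_rev]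
    omega
  have h3 : Matrix.vandermonde ((fun i : Fin n => ((i : ℕ) : ℤ)) ∘ Fin.revPerm) =
    (Matrix.vandermonde (fun i : Fin n => ((i : ℕ) : ℤ))).submatrix Fin.revPerm id := rfl
  rw [h3, Matrix.det_permute] at h1
  have := mul_right_cancel₀ (Matrix.det_vandermonde_ne_zero_iff.2 hmono.injective) h1
  apply Units.ext
  simpa using this

theorem pairProd_comp {n : ℕ} (d : Fin n → ℤ) (σ : Equiv.Perm (Fin n)) :
    pairProd (d ∘ σ) = pairProd d := by
  simp only [pairProd, Finset.prod_filter, Function.comp_apply]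
  rw [← Equiv.prod_comp σ (fun i => ∏ i', if d i' < d i then d i - d i' else 1)]
  refine Finset.prod_congr rfl fun i _ => ?_
  exact Equiv.prod_comp σ (fun i' => if d i' < d (σ i) then d (σ i) - d i' else 1)

/-! ### The coefficient contributed by a single permutation -/

section

variable {n : ℕ} {k m : Fin n → ℕ} {σ : Equiv.Perm (Fin n)}

theorem mem_S : σ ∈ S k m ↔ ∀ i, m i ≤ k (σ i) := by
  simp [S, D, diff]

theorem mem_T : σ ∈ T k m ↔ σ ∈ S k m ∧ Function.Injective (diff k m σ) := by
  have h := Finset.card_image_iff (s := (univ : Finset (Fin n))) (f := diff k m σ)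
  simp only [card_univ, Fintype.card_fin, coe_univ, Set.injOn_univ] at h
  have hD : (D k m σ).card = n ↔ Function.Injective (diff k m σ) := h
  rw [T, S, mem_filter, mem_filter, hD, and_assoc]

theorem diff_nonneg (hσ : σ ∈ S k m) (i : Fin n) : 0 ≤ diff k m σ i := by
  have := mem_S.1 hσ i
  simp only [diff]
  omega

theorem sorts_iff (hσ : σ ∈ T k m) (τ : Equiv.Perm (Fin n)) :
    Sorts k m σ τ ↔ τ = sortPerm k m σ := by
  obtain ⟨hS, hinj⟩ := mem_T.1 hσ
  rw [sortPerm, Tuple.eq_sort_iff]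
  constructor
  · rintro ⟨_, h⟩
    exact ⟨h.monotone, fun i j hij he => absurd (h hij) (by simp [he])⟩
  · rintro ⟨h, _⟩
    exact ⟨fun i => diff_nonneg hS _, h.strictMono_of_injective (hinj.comp τ.injective)⟩

/-- The exponents `j ↦ k_j - m_{σ⁻¹(j)}`. -/
noncomputable def restExp (k m : Fin n → ℕ) (σ : Equiv.Perm (Fin n)) : Fin n →₀ ℕ :=
  Finsupp.equivFunOnFinite.symm fun j => k j - m (σ⁻¹ j)

theorem restExp_apply (hσ : σ ∈ S k m) (i : Fin n) :
    (restExp k m σ (σ i) : ℤ) = diff k m σ i := by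
  have := mem_S.1 hσ i
  simp [restExp, diff, Nat.cast_sub this]

theorem sum_restExp (hσ : σ ∈ S k m) : ∑ i, restExp k m σ i = ∑ i, k i - ∑ i, m i := by
  have h (j : Fin n) : m (σ⁻¹ j) ≤ k j := by simpa using mem_S.1 hσ (σ⁻¹ j)
  rw [← Equiv.sum_comp σ⁻¹ m, ← Finset.sum_tsub_distrib _ fun j _ => h j]
  rfl

theorem prod_factorial_restExp (hσ : σ ∈ S k m) :
    ∏ i, ((restExp k m σ i).factorial : ℤ) = ∏ i, ((diff k m σ i).toNat.factorial : ℤ) := by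
  rw [← Equiv.prod_comp σ]
  refine Finset.prod_congr rfl fun i _ => ?_
  rw [← restExp_apply hσ, Int.toNat_natCast]

theorem denN_pos (δ : ℕ) : 0 < denN k m δ σ :=
  Finset.prod_pos fun i _ => Finset.prod_pos fun j hj => by simp at hj; omega

theorem numN_pos (δ : ℕ) : 0 < numN k m δ := by
  simpa [numN] using Nat.factorial_pos _

theorem denN_zero (hσ : σ ∈ S k m) :
    denN k m 0 σ = ∏ i, ((restExp k m σ i).factorial : ℤ) := by
  rw [prod_factorial_restExp hσ, denN]
  refine Finset.prod_congr rfl fun i _ => ?_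
  simp [prod_Ico_sub (diff_nonneg hσ i)]

theorem denN_one_mul (hσ : σ ∈ T k m) :
    denN k m 1 σ * pairProd (diff k m σ) = ∏ i, ((restExp k m σ i).factorial : ℤ) := by
  obtain ⟨hS, hinj⟩ := mem_T.1 hσ
  rw [prod_factorial_restExp hS, prod_factorial_eq (diff_nonneg hS) hinj, denN]
  simp [D]

theorem coeff_zero_mul_denN (hσ : σ ∈ S k m) :
    coeff (restExp k m σ) ((∑ s, X s : MvPolynomial (Fin n) ℤ) ^ (∑ i, k i - totalM m 0)) *
      denN k m 0 σ = numN k m 0 := by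
  have h := Nat.multinomial_spec univ (restExp k m σ)
  rw [coeff_sum_X_pow, denN_zero hσ, if_pos (by simp [sum_restExp hσ, totalM]), numN, mul_comm]
  rw [sum_restExp hσ] at h
  simp only [totalM, zero_mul, add_zero, ← h]
  push_cast
  rfl

theorem coeff_one_mul_prod (hσ : σ ∈ S k m) (hM : totalM m 1 ≤ ∑ i, k i) :
    coeff (restExp k m σ) (vandermondePow ℤ n 1 *
        (∑ s, X s : MvPolynomial (Fin n) ℤ) ^ (∑ i, k i - totalM m 1)) *
      ∏ i, ((restExp k m σ i).factorial : ℤ) =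
      numN k m 1 * (Matrix.vandermonde fun i => (restExp k m σ i : ℤ)).det := by
  refine coeff_vandermondePow_one_mul _ _ ?_
  rw [sum_restExp hσ]
  simp only [totalM] at hM ⊢
  omega

theorem coeff_one_mul_denN (hσ : σ ∈ T k m) (hM : totalM m 1 ≤ ∑ i, k i) :
    coeff (restExp k m σ) (vandermondePow ℤ n 1 *
        (∑ s, X s : MvPolynomial (Fin n) ℤ) ^ (∑ i, k i - totalM m 1)) *
      denN k m 1 σ = (Equiv.Perm.sign (σ * sortPerm k m σ) : ℤ) * numN k m 1 := by
  have hS := (mem_T.1 hσ).1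
  have h := coeff_one_mul_prod hS hM
  have hd : (fun i => (restExp k m σ i : ℤ)) ∘ σ = diff k m σ :=
    funext fun i => restExp_apply hS i
  -- The exponents are indexed by columns: `σ` carries them to the differences indexed by rows,
  -- which `σ'` sorts. Hence the sign of `σσ'` rather than of `σ'`.
  have hs : StrictMono ((fun i => (restExp k m σ i : ℤ)) ∘ (σ * sortPerm k m σ)) := by
    rw [Equiv.Perm.coe_mul, ← Function.comp_assoc, hd]
    exact ((sorts_iff hσ _).2 rfl).2
  rw [det_vandermonde_eq_sign_mul hs, ← denN_one_mul hσ, ← hd,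
    pairProd_comp, ← mul_assoc,
    ← mul_assoc] at h
  rw [mul_right_cancel₀ (pairProd_pos _).ne' h, mul_comm]

/-- Outside `T` two exponents coincide, which kills the Vandermonde determinant, while the
factorials are nonzero in `ℤ`. -/
theorem coeff_one_eq_zero (hσ : σ ∈ S k m) (hT : σ ∉ T k m) (hM : totalM m 1 ≤ ∑ i, k i) :
    coeff (restExp k m σ) (vandermondePow ℤ n 1 *
        (∑ s, X s : MvPolynomial (Fin n) ℤ) ^ (∑ i, k i - totalM m 1)) = 0 := by
  have h := coeff_one_mul_prod hσ hM
  have hd : (fun i => (restExp k m σ i : ℤ)) ∘ σ = diff k m σ :=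
    funext fun i => restExp_apply hσ i
  have h0 : (Matrix.vandermonde fun i => (restExp k m σ i : ℤ)).det = 0 := by
    by_contra hne
    refine hT (mem_T.2 ⟨hσ, ?_⟩)
    rw [← hd]
    exact (Matrix.det_vandermonde_ne_zero_iff.1 hne).comp σ.injective
  rw [h0, mul_zero] at h
  refine (mul_eq_zero.1 h).resolve_right (Finset.prod_ne_zero_iff.2 fun i _ => ?_)
  exact_mod_cast (Nat.factorial_pos _).ne'

/-- Since `ε² = 1`, the integer `ε * c` is the exact quotient; it is positive because numerator and
denominator are. -/
theorem denN_dvd_and_eq {δ : ℕ} {c : ℤ} {ε : ℤˣ} (h : c * denN k m δ σ = ε * numN k m δ) :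
    (denN k m δ σ ∣ numN k m δ ∧ 0 < N k m δ σ) ∧ c = ε * N k m δ σ := by
  have hu : (ε : ℤ) * ε = 1 := by rw [← Units.val_mul, Int.units_mul_self, Units.val_one]
  have h1 : numN k m δ = (ε * c) * denN k m δ σ := by
    rw [mul_assoc, h, ← mul_assoc, hu, one_mul]
  have h2 : N k m δ σ = ε * c := by
    rw [N, h1, Int.mul_ediv_cancel _ (denN_pos δ).ne']
  refine ⟨⟨⟨ε * c, by rw [h1, mul_comm]⟩, ?_⟩, by rw [h2, ← mul_assoc, hu, one_mul]⟩
  have := numN_pos (k := k) (m := m) δ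
  rw [h1] at this
  rw [h2]
  exact pos_of_mul_pos_left this (denN_pos δ).le

theorem coeffAt_permanent_mul {R : Type*} [CommRing R] (A : Matrix (Fin n) (Fin n) R)
    (k m : Fin n → ℕ) (P : MvPolynomial (Fin n) R) :
    coeffAt k ((weightedMatrix A m).permanent * P) =
      ∑ σ ∈ S k m, coeff (restExp k m σ) P * ∏ i, A i (σ i) := by
  -- `Matrix.permanent` multiplies entries `(σ i, i)`; passing to `σ⁻¹` gives the entries `(i, σ
  -- i)`.
  rw [coeffAt, Matrix.permanent, ← Equiv.sum_comp (Equiv.inv _), Finset.sum_mul, coeff_sum, S,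
    Finset.sum_filter]
  refine Finset.sum_congr rfl fun σ _ => ?_
  have h1 : ∏ i, weightedMatrix A m ((Equiv.inv (Equiv.Perm (Fin n))) σ i) i =
      monomial (Finsupp.equivFunOnFinite.symm fun j => m (σ⁻¹ j)) (∏ i, A i (σ i)) := by
    rw [monomial_eq, Finsupp.prod_fintype _ _ (by simp), map_prod,
      ← Equiv.prod_comp σ⁻¹ fun i => C (A i (σ i)), ← Finset.prod_mul_distrib]
    simp [weightedMatrix]
  rw [h1, mul_comm, coeff_mul_monomial']
  have h2 : ((Finsupp.equivFunOnFinite.symm fun j => m (σ⁻¹ j)) ≤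
      Finsupp.equivFunOnFinite.symm k) ↔ ∀ d ∈ D k m σ, 0 ≤ d := by
    have : σ ∈ S k m ↔ ∀ d ∈ D k m σ, 0 ≤ d := by simp [S]
    rw [← this, mem_S, Finsupp.le_def]
    refine ⟨fun h i => by simpa using h (σ i), fun h i => by simpa using h (σ⁻¹ i)⟩
  have h3 : ((Finsupp.equivFunOnFinite.symm k - Finsupp.equivFunOnFinite.symm fun j =>
      m (σ⁻¹ j)) : Fin n →₀ ℕ) = restExp k m σ := by
    ext j
    rfl
  simp only [h2, h3]

/-- This transfers the integer computation, which divides by factorials, to an arbitrary ring `R`.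
-/
theorem coeff_intCast (R : Type*) [CommRing R] (d : Fin n →₀ ℕ) (δ M : ℕ) :
    coeff d (vandermondePow R n δ * (∑ s, X s) ^ M) =
      ((coeff d (vandermondePow ℤ n δ * (∑ s, X s) ^ M) : ℤ) : R) := by
  rw [← eq_intCast (Int.castRingHom R), ← coeff_map]
  simp [vandermondePow]

end

theorem coeffAt_permanent_mul_vandermondePow {R : Type*} [CommRing R] {n : ℕ} (A : Matrix (Fin n) (Fin n) R)
    (k m : Fin n → ℕ) (δ : ℕ) (hδ : δ = 0 ∨ δ = 1) (hM : totalM m δ ≤ ∑ i, k i) :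
    (∀ σ ∈ (if δ = 0 then S k m else T k m),
      denN k m δ σ ∣ numN k m δ ∧ 0 < N k m δ σ) ∧
    (∀ σ ∈ T k m, ∀ τ : Equiv.Perm (Fin n), Sorts k m σ τ ↔ τ = sortPerm k m σ) ∧
    coeffAt k ((weightedMatrix A m).permanent * vandermondePow R n δ *
          (∑ s, X s) ^ (∑ i, k i - totalM m δ)) =
      if δ = 0 then ∑ σ ∈ S k m, (N k m δ σ : R) * ∏ i, A i (σ i)
      else ∑ σ ∈ T k m, ((Equiv.Perm.sign (σ * sortPerm k m σ) : ℤ) : R) *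
              (N k m δ σ : R) * ∏ i, A i (σ i) := by
  rw [mul_assoc, coeffAt_permanent_mul]
  simp only [coeff_intCast R]
  obtain rfl | rfl := hδ
  · have key {σ} (hσ : σ ∈ S k m) := denN_dvd_and_eq (ε := 1)
      ((coeff_zero_mul_denN hσ).trans (by simp))
    have hv : vandermondePow ℤ n 0 = 1 := by simp [vandermondePow]
    simp only [if_true, hv, one_mul]
    refine ⟨fun σ hσ => (key hσ).1, fun σ => sorts_iff, Finset.sum_congr rfl fun σ hσ => ?_⟩
    rw [(key hσ).2]
    simp
  · have key {σ} (hσ : σ ∈ T k m) := denN_dvd_and_eq (coeff_one_mul_denN hσ hM)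
    simp only [one_ne_zero, if_false]
    refine ⟨fun σ hσ => (key hσ).1, fun σ => sorts_iff, ?_⟩
    rw [← Finset.sum_subset (fun σ hσ => (mem_T.1 hσ).1)]
    · refine Finset.sum_congr rfl fun σ hσ => ?_
      rw [(key hσ).2]
      push_cast
      rfl
    · intro σ hS hT
      rw [coeff_one_eq_zero hS hT hM]
      simp

/-! ### Constant exponents -/

section

variable {n : ℕ} {k : ℕ} {m : Fin n → ℕ}

theorem mem_S_const (hk : ∀ i, m i ≤ k) (σ : Equiv.Perm (Fin n)) : σ ∈ S (fun _ => k) m :=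
  mem_S.2 hk

theorem mem_T_const (hk : ∀ i, m i ≤ k) (hm : StrictMono m) (σ : Equiv.Perm (Fin n)) :
    σ ∈ T (fun _ => k) m :=
  mem_T.2 ⟨mem_S.2 hk, fun i j h => hm.injective (by simp only [diff] at h; omega)⟩

theorem sortPerm_const (hk : ∀ i, m i ≤ k) (hm : StrictMono m) (σ : Equiv.Perm (Fin n)) :
    sortPerm (fun _ => k) m σ = Fin.revPerm := by
  symm
  refine (sorts_iff (mem_T_const hk hm σ) _).1
    ⟨fun i => diff_nonneg (mem_S_const hk σ) _, fun i j h => ?_⟩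
  have := hm (Fin.rev_lt_rev.2 h)
  simp only [diff, Fin.revPerm_apply]
  omega

/-- The `j`-th value of `m` from the top, counting from zero, is at most `k - j`; sum over `j`. -/
theorem totalM_one_le (hk : ∀ i, m i ≤ k) (hm : StrictMono m) :
    ∑ i, m i + n.choose 2 ≤ k * n := by
  have h (j : ℕ) : ∀ hj : j < n, m (Fin.rev ⟨j, hj⟩) + j ≤ k := by
    induction j with
    | zero => exact fun hj => hk _
    | succ j ih =>
      intro hj
      have h1 := ih (by omega)
      have h2 := hm (Fin.rev_lt_rev.2 (show (⟨j, by omega⟩ : Fin n) < ⟨j + 1, hj⟩ by simp))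
      omega
  rw [← sum_val_fin, ← Equiv.sum_comp Fin.revPerm m, ← Finset.sum_add_distrib]
  refine (Finset.sum_le_sum fun (i : Fin n) _ => h i i.isLt).trans ?_
  simp [mul_comm]

theorem denN_const_zero (hk : ∀ i, m i ≤ k) (σ : Equiv.Perm (Fin n)) :
    denN (fun _ => k) m 0 σ = (den₀ k m : ℤ) := by
  rw [denN_zero (mem_S_const hk σ), prod_factorial_restExp (mem_S_const hk σ), den₀]
  push_cast
  refine Finset.prod_congr rfl fun i _ => ?_
  have : (diff (fun _ => k) m σ i).toNat = k - m i := by simp only [diff]; omega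
  rw [this]

theorem denN_const_one (hm : StrictMono m) (σ : Equiv.Perm (Fin n)) :
    denN (fun _ => k) m 1 σ = (den₁ k m : ℤ) := by
  rw [denN, den₁]
  push_cast
  refine Finset.prod_congr rfl fun i _ => ?_
  symm
  -- The reflection `j ↦ k - j` takes the values of `m` to `D_σ`. As `j > m i`, strict monotonicity
  -- means only the values `m s` with `s > i` can be excluded.
  refine Finset.prod_bij (fun j _ => (k : ℤ) - j) ?_ ?_ ?_ ?_
  · intro j hj
    simp only [mem_filter, mem_Ioc, mem_image, mem_Ioi, not_exists, not_and, mem_Ico, D, diff,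
      mem_univ, true_and, forall_const] at hj ⊢
    obtain ⟨⟨h1, h2⟩, h3⟩ := hj
    refine ⟨by omega, fun s hs => ?_⟩
    have hs' : m s = j := by omega
    exact h3 s (hm.lt_iff_lt.1 (hs' ▸ h1)) hs'
  · intro a _ b _ hab
    simpa using hab
  · intro b hb
    simp only [mem_filter, mem_Ioc, mem_image, mem_Ioi, not_exists, not_and, mem_Ico, D, diff,
      mem_univ, true_and, forall_const] at hb ⊢
    obtain ⟨⟨h1, h2⟩, h3⟩ := hb
    exact ⟨(k - b).toNat, ⟨by omega, fun s _ hs => h3 s (by omega)⟩, by omega⟩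
  · intro j hj
    have : m i < j := (mem_Ioc.1 (mem_filter.1 hj).1).1
    rw [Nat.cast_sub this.le, diff]
    ring

theorem coeffAt_const_permanent_mul_sum_pow {R : Type*} [CommRing R] (A : Matrix (Fin n) (Fin n) R)
    (hk : ∀ i, m i ≤ k) :
    den₀ k m ∣ (k * n - ∑ i, m i).factorial ∧
    coeffAt (fun _ => k) ((weightedMatrix A m).permanent *
        (∑ s, X s) ^ (k * n - ∑ i, m i)) =
      (((k * n - ∑ i, m i).factorial / den₀ k m : ℕ) : R) * A.permanent := by
  have hs : k * n - ∑ i, m i = ∑ _i : Fin n, k - totalM m 0 := by simp [totalM, mul_comm]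
  have hM : totalM m 0 ≤ ∑ _i : Fin n, k := by
    simpa [totalM] using Finset.sum_le_sum fun i (_ : i ∈ univ) => hk i
  obtain ⟨h1, -, h3⟩ := coeffAt_permanent_mul_vandermondePow A (fun _ => k) m 0 (Or.inl rfl) hM
  have hnum : numN (fun _ => k) m 0 = ((k * n - ∑ i, m i).factorial : ℤ) := by
    rw [numN, hs]
  -- The denominator is the same for all permutations, so the identity suffices.
  have hdvd := (h1 1 (mem_S_const hk 1)).1
  rw [denN_const_zero hk, hnum, Int.natCast_dvd_natCast] at hdvd
  refine ⟨hdvd, ?_⟩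
  have hv : vandermondePow R n 0 = 1 := by simp [vandermondePow]
  rw [hv, mul_one, ← hs, if_pos rfl,
    Finset.eq_univ_iff_forall.2 (mem_S_const hk)] at h3
  rw [h3, ← Matrix.permanent_transpose, Matrix.permanent, Finset.mul_sum]
  refine Finset.sum_congr rfl fun σ _ => ?_
  rw [N, denN_const_zero hk, hnum, ← Int.natCast_div, Int.cast_natCast]
  rfl

theorem coeffAt_const_permanent_mul_vandermonde {R : Type*} [CommRing R] (A : Matrix (Fin n) (Fin n) R)
    (hk : ∀ i, m i ≤ k) (hm : StrictMono m) :
    den₁ k m ∣ (k * n - n.choose 2 - ∑ i, m i).factorial ∧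
    coeffAt (fun _ => k) ((weightedMatrix A m).permanent * vandermondePow R n 1 *
        (∑ s, X s) ^ (k * n - n.choose 2 - ∑ i, m i)) =
      (-1) ^ n.choose 2 *
        (((k * n - n.choose 2 - ∑ i, m i).factorial / den₁ k m : ℕ) : R) * A.det := by
  have hle := totalM_one_le hk hm
  have hs : k * n - n.choose 2 - ∑ i, m i = ∑ _i : Fin n, k - totalM m 1 := by
    simp only [totalM, sum_const, card_univ, Fintype.card_fin, smul_eq_mul, mul_comm n]
    omega
  have hM : totalM m 1 ≤ ∑ _i : Fin n, k := by
    simpa [totalM, mul_comm] using hle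
  obtain ⟨h1, -, h3⟩ := coeffAt_permanent_mul_vandermondePow A (fun _ => k) m 1 (Or.inr rfl) hM
  have hnum : numN (fun _ => k) m 1 = ((k * n - n.choose 2 - ∑ i, m i).factorial : ℤ) := by
    rw [numN, hs]
  have hdvd := (h1 1 (mem_T_const hk hm 1)).1
  rw [denN_const_one hm, hnum, Int.natCast_dvd_natCast] at hdvd
  refine ⟨hdvd, ?_⟩
  rw [← hs, if_neg one_ne_zero, Finset.eq_univ_iff_forall.2 (mem_T_const hk hm)] at h3
  rw [h3, ← Matrix.det_transpose, Matrix.det_apply', Finset.mul_sum]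
  refine Finset.sum_congr rfl fun σ _ => ?_
  -- The reversal contributes the global sign, and the remaining `sign σ` makes the sum a
  -- determinant.
  rw [N, denN_const_one hm, hnum, ← Int.natCast_div, Int.cast_natCast, sortPerm_const hk hm,
    Equiv.Perm.sign_mul, sign_revPerm]
  simp only [Matrix.transpose_apply]
  push_cast
  ring

end

end PermanentDual

theorem theorem3p2 {R : Type*} [CommRing R] {n : ℕ} (A : Matrix (Fin n) (Fin n) R) :
    -- Part (i)
    (∀ (k m : Fin n → ℕ) (δ : ℕ), (δ = 0 ∨ δ = 1) →
      PermanentDual.totalM m δ ≤ ∑ i, k i →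
      -- `N_σ` is a positive integer (an exact quotient) for every `σ` that is summed over
      (∀ σ ∈ (if δ = 0 then PermanentDual.S k m else PermanentDual.T k m),
        PermanentDual.denN k m δ σ ∣ PermanentDual.numN k m δ ∧ 0 < PermanentDual.N k m δ σ) ∧
      -- `σ'` is the unique permutation that sorts the `k_{σ(i)} - m_i`
      (∀ σ ∈ PermanentDual.T k m, ∀ τ : Equiv.Perm (Fin n),
        PermanentDual.Sorts k m σ τ ↔ τ = PermanentDual.sortPerm k m σ) ∧
      PermanentDual.coeffAt k
          ((PermanentDual.weightedMatrix A m).permanent * PermanentDual.vandermondePow R n δ *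
            (∑ s, MvPolynomial.X s) ^ (∑ i, k i - PermanentDual.totalM m δ)) =
        if δ = 0 then
          ∑ σ ∈ PermanentDual.S k m, (PermanentDual.N k m δ σ : R) * ∏ i, A i (σ i)
        else
          ∑ σ ∈ PermanentDual.T k m,
            ((Equiv.Perm.sign (σ * PermanentDual.sortPerm k m σ) : ℤ) : R) *
              (PermanentDual.N k m δ σ : R) * ∏ i, A i (σ i)) ∧
    -- Part (ii)
    (∀ (k : ℕ) (m : Fin n → ℕ), Monotone m → (∀ i, m i ≤ k) →
      (PermanentDual.den₀ k m ∣ Nat.factorial (k * n - ∑ i, m i) ∧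
        PermanentDual.coeffAt (fun _ => k)
            ((PermanentDual.weightedMatrix A m).permanent *
              (∑ s, MvPolynomial.X s) ^ (k * n - ∑ i, m i)) =
          ((Nat.factorial (k * n - ∑ i, m i) / PermanentDual.den₀ k m : ℕ) : R) * A.permanent) ∧
      (StrictMono m →
        n.choose 2 + ∑ i, m i ≤ k * n ∧
        PermanentDual.den₁ k m ∣ Nat.factorial (k * n - n.choose 2 - ∑ i, m i) ∧
        PermanentDual.coeffAt (fun _ => k)
            ((PermanentDual.weightedMatrix A m).permanent * PermanentDual.vandermondePow R n 1 *
              (∑ s, MvPolynomial.X s) ^ (k * n - n.choose 2 - ∑ i, m i)) =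
          (-1) ^ n.choose 2 *
            ((Nat.factorial (k * n - n.choose 2 - ∑ i, m i) / PermanentDual.den₁ k m : ℕ) : R) *
            A.det)) := by
  refine ⟨PermanentDual.coeffAt_permanent_mul_vandermondePow A, fun k m _ hk =>
    ⟨PermanentDual.coeffAt_const_permanent_mul_sum_pow A hk, fun hm => ⟨?_,
      PermanentDual.coeffAt_const_permanent_mul_vandermonde A hk hm⟩⟩⟩
  rw [add_comm]
  exact PermanentDual.totalM_one_le hk hm
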